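/- Let $\delta,r>0$ and $0<\xi<1$. Let $f(x)=\frac12 x^\top Mx$ on $\mathbb R^d$, where $M$ is a symmetric matrix all of whose eigenvalues have absolute value at most $L$, and let $S=\{x\mid Ax\le 0\}$ be defined by $k$ linear inequalities $A_i^\top x\le 0$. Write $\mathcal B(r)$ for the closed ball of radius $r$ around $0$. Suppose that $0$ is a $(\delta,r)$-quadratic corner saddle point, i.e. $\min_{x\in S\cap\mathcal B(r)}f(x)<-\delta$. Consider the following algorithm with an iteration number $T$. For each subset $I\subseteq[k]$ (in any order), let $\mathcal A_I=\{x\mid A_i^\top x=0\text{ for all }i\in I\}$, draw an independent $\zeta\sim\mathcal N(0,\mathrm{Id})$, run the projected power method $$x_0=\mathrm{proj}_{\mathcal A_I}(\zeta),\qquad x_{t+1}=\mathrm{proj}_{\mathcal A_I}\Bigl(x_t-\tfrac1L\bigl(\nabla f(x_t)-\nabla f(0)\bigr)\Bigr)\quad(0\le t<T),$$ and put $e=r\,x_T/\|x_T\|$ (with $e=0$ if $x_T=0$). If $e\in S$ and $f(e)<f(0)-\frac\delta2$, return $e$; otherwise, if $-e\in S$ and $f(-e)<f(0)-\frac\delta2$,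 return $-e$; otherwise continue with the next subset. If no subset succeeds, report failure. There is an absolute constant $C$ such that, for a suitable $T$ depending only on $d,k,L,\delta,r,\xi$, the algorithm finds, with probability at least $1-\xi$, a point $x\in S\cap\mathcal B(r)$ with $f(x)<-\delta/2$ (in particular $f(x)<-\Omega(\delta)$), and it always makes at most $$C\cdot\frac{L\,r^2\,\max\{k,1\}\,2^k}{\delta}\,\log\frac{2d}{\xi}$$ calls to the (deterministic, exact) gradient oracle. -/

import Mathlib

noncomputable section

/-- The Euclidean space `ℝ^d`. -/
abbrev Euc (d : ℕ) : Type := EuclideanSpace ℝ (Fin d)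

/-! ### The optimization problem -/

/-- `λ_{|max|}(M)`: the largest absolute value of an eigenvalue of a symmetric real matrix. -/
def lambdaAbsMax {d : ℕ} {M : Matrix (Fin d) (Fin d) ℝ} (hM : M.IsHermitian) : ℝ :=
  ⨆ i, |hM.eigenvalues i|

/-- The quadratic objective `f(x) = ½ xᵀ M x`. -/
def quadForm {d : ℕ} (M : Matrix (Fin d) (Fin d) ℝ) (x : Euc d) : ℝ :=
  (1 / 2) * (x.ofLp ⬝ᵥ M.mulVec x.ofLp)

/-- The polyhedral cone `{y | A (y - x) ≤ 0}` with corner `x`; the rows of `A` are the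
constraints. -/
def cornerCone {d k : ℕ} (A : Matrix (Fin k) (Fin d) ℝ) (x : Euc d) : Set (Euc d) :=
  {y | ∀ i, A.mulVec (y - x).ofLp i ≤ 0}

/-- `0` is a `(δ, r)`-quadratic corner saddle point: the minimum of `f` over the intersection of
the closed ball `B(r)` with `S` is less than `-δ`. (For continuous `f` and closed `S ∋ 0` the minimum
is attained, so this says that some point there has value less than `-δ`.) -/
def IsQCSP {d : ℕ} (f : Euc d → ℝ) (S : Set (Euc d)) (δ r : ℝ) : Prop :=
  ∃ x ∈ Metric.closedBall (0 : Euc d) r ∩ S, f x < -δ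

/-! ### Programs with oracle access to the objective -/

/-- A program that accesses an unknown function `f : E → ℝ` only by adaptive queries
to a gradient oracle and to a value oracle, and finally returns an element of `α`. -/
inductive OracleProg (E α : Type) : Type
  /-- stop and return `a` -/
  | ret (a : α) : OracleProg E α
  /-- query `∇f(x)` and continue depending on the answer -/
  | grad (x : E) (next : E → OracleProg E α) : OracleProg E α
  /-- query `f(x)` and continue depending on the answer -/
  | value (x : E) (next : ℝ → OracleProg E α) : OracleProg E α

namespace OracleProg

/-- Sequential composition: run `p`, then run `q` on the result. -/
def bind {E α β : Type} (p : OracleProg E α) (q : α → OracleProg E β) : OracleProg E β :=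
  match p with
  | ret a => q a
  | grad x next => grad x fun g => (next g).bind q
  | value x next => value x fun v => (next v).bind q

/-- The result of a program when the oracles answer exactly with `∇f` and `f`. -/
def eval {d : ℕ} {α : Type} (f : Euc d → ℝ) : OracleProg (Euc d) α → α
  | ret a => a
  | grad x next => (next (gradient f x)).eval f
  | value x next => (next (f x)).eval f

/-- The number of gradient oracle calls that a program makes on `f`. -/
def gradCalls {d : ℕ} {α : Type} (f : Euc d → ℝ) : OracleProg (Euc d) α → ℕ
  | ret _ => 0
  | grad x next => (next (gradient f x)).gradCalls f + 1
  | value x next => (next (f x)).gradCalls f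

end OracleProg

/-! ### The algorithm -/

/-- The linear subspace `{v | A_iᵀ v = 0 for all i ∈ I}`. -/
def activeDirections {d k : ℕ} (A : Matrix (Fin k) (Fin d) ℝ) (I : Finset (Fin k)) :
    Submodule ℝ (Euc d) where
  carrier := {v | ∀ i ∈ I, A.mulVec v.ofLp i = 0}
  add_mem' := by
    intro a b ha hb i hi
    simp [Matrix.mulVec_add, ha i hi, hb i hi]
  zero_mem' := by
    intro i _
    simp
  smul_mem' := by
    intro c a ha i hi
    simp [Matrix.mulVec_smul, ha i hi]

/-- The affine subspace `{y | A_iᵀ (y - x) = 0 for all i ∈ I}`. -/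
abbrev activeSubspace {d k : ℕ} (A : Matrix (Fin k) (Fin d) ℝ) (x : Euc d)
    (I : Finset (Fin k)) : AffineSubspace ℝ (Euc d) :=
  AffineSubspace.mk' x (activeDirections A I)

/-- Euclidean projection onto a nonempty affine subspace. -/
def proj {d : ℕ} (𝒜 : AffineSubspace ℝ (Euc d)) [Nonempty 𝒜] (z : Euc d) : Euc d :=
  (EuclideanGeometry.orthogonalProjection 𝒜 z : Euc d)

/-- The loop of the projected power method: `T` steps
`z ← proj_𝒜 (z - η (∇f(z) - ∇f(x)))`. Both gradients are queried (and counted) in every step. -/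
def powerLoop {d : ℕ} (x : Euc d) (𝒜 : AffineSubspace ℝ (Euc d)) [Nonempty 𝒜] (η : ℝ) :
    ℕ → Euc d → OracleProg (Euc d) (Euc d)
  | 0, z => .ret z
  | T + 1, z => .grad z fun g => .grad x fun g₀ => powerLoop x 𝒜 η T (proj 𝒜 (z - η • (g - g₀)))

/-- The projected power method in `𝒜` started from `proj_𝒜 (x + noise)`. It returns
`e = r (x_T - x) / ‖x_T - x‖` (which is `0` if `x_T = x`). -/
def findInsideCorner {d : ℕ} (x : Euc d) (𝒜 : AffineSubspace ℝ (Euc d)) [Nonempty 𝒜]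
    (r η : ℝ) (T : ℕ) (noise : Euc d) : OracleProg (Euc d) (Euc d) :=
  (powerLoop x 𝒜 η T (proj 𝒜 (x + noise))).bind fun xT =>
    .ret ((r / ‖xT - x‖) • (xT - x))

open Classical in
/-- The exhaustive search over the sets `I` of constraints in a given list. For each `I`, the
projected power method is run in the affine subspace where the constraints from `I` are active,
with the initial noise `noise I`; the first candidate among `x + e`, `x - e` that lies in the cone
and improves the value by more than `δ / 2` is returned. The result `none` is failure. -/
def houdiniEscapeCorner {d k : ℕ} (x : Euc d) (A : Matrix (Fin k) (Fin d) ℝ) (δ r η : ℝ) (T : ℕ)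
    (noise : Finset (Fin k) → Euc d) :
    List (Finset (Fin k)) → OracleProg (Euc d) (Option (Euc d))
  | [] => .ret none
  | I :: rest =>
    (findInsideCorner x (activeSubspace A x I) r η T (noise I)).bind fun e =>
      .value x fun fx =>
        .value (x + e) fun fPlus =>
          if x + e ∈ cornerCone A x ∧ fPlus < fx - δ / 2 then .ret (some (x + e))
          else .value (x - e) fun fMinus =>
            if x - e ∈ cornerCone A x ∧ fMinus < fx - δ / 2 then .ret (some (x - e))
            else houdiniEscapeCorner x A δ r η T noise rest

/-- The law of the randomness of the algorithm: independent standard Gaussian vectors in `ℝ^d`,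
one for each set of constraints. -/
def noiseLaw (d k : ℕ) : MeasureTheory.Measure (Finset (Fin k) → Euc d) :=
  MeasureTheory.Measure.pi fun _ => ProbabilityTheory.stdGaussian (Euc d)

end

open MeasureTheory ProbabilityTheory
open scoped RealInnerProductSpace

/-! Suppose the cone contains a point `x` with the constraints from `I` active and `f x < c / r² *
‖x‖²`. Unless the noise is almost orthogonal to a top eigenvector, the power method for `I` yields
`e` of norm `r` with `f e < c + ε` (`exists_direction_findInsideCorner`). If `e` or `-e` lies in the
cone and `c + ε ≤ -δ / 2`, the search succeeds. Otherwise put `g = f - (c + ε) / r² * ‖·‖²`, which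
is negative at `x` and at `±e`. For one choice of sign the cross term of `g` is nonpositive, so `g <
0` on the whole segment from `x` to `±e`, and the point where this segment leaves the cone lies in a
smaller face (`exists_mem_smaller_face`). Descending through at most `k` constraints costs `ε` each
time, so `ε = δ / (2 (k + 1))` suffices.

The exit point depends on the noise, but no conditioning is needed: either every good noise for `I`
succeeds, or one fixed good noise that fails provides a deterministic point in a smaller face
(`noiseLaw_no_escape_le`).

The iteration count needs neither a spectral gap nor a factor `log (1 / ε)`: by log-convexity of the
moments, `T` steps lose only a relative `Λ / (2 T)` of the top eigenvalue
(`rayleigh_power_iterate_ge`). -/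

/-! ### Power iteration -/

/-- A log-convex sequence of positive numbers satisfies `a n ≤ (a (n + 1) / a n) ^ n * a 0`. -/
theorem le_ratio_pow_mul_of_logConvex {a : ℕ → ℝ} (hpos : ∀ j, 0 < a j)
    (hconv : ∀ j, a (j + 1) ^ 2 ≤ a j * a (j + 2)) (n : ℕ) :
    a n ≤ (a (n + 1) / a n) ^ n * a 0 := by
  have hmono : Monotone fun j => a (j + 1) / a j := by
    refine monotone_nat_of_le_succ fun j => ?_
    rw [div_le_div_iff₀ (hpos _) (hpos _)]
    nlinarith [hconv j]
  have key : ∀ j ≤ n, a j ≤ (a (n + 1) / a n) ^ j * a 0 := by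
    intro j
    induction j with
    | zero => simp
    | succ j ih =>
      intro hj
      have h1 : a (j + 1) = a (j + 1) / a j * a j := by
        field_simp [(hpos j).ne']
      have h2 : a (j + 1) / a j ≤ a (n + 1) / a n := hmono (by omega)
      have h3 := ih (by omega)
      have h4 : 0 ≤ a (n + 1) / a n := (div_pos (hpos _) (hpos _)).le
      calc a (j + 1) = a (j + 1) / a j * a j := h1
        _ ≤ (a (n + 1) / a n) * ((a (n + 1) / a n) ^ j * a 0) :=
          mul_le_mul h2 h3 (hpos j).le h4
        _ = _ := by ring
  exact key n le_rfl

section PowerIteration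

variable {E : Type*} [NormedAddCommGroup E] [InnerProductSpace ℝ E]

theorem inner_pow_apply_left {T : E →ₗ[ℝ] E} (hT : T.IsSymmetric) (i : ℕ) (x y : E) :
    ⟪(T ^ i) x, y⟫ = ⟪x, (T ^ i) y⟫ := by
  induction i generalizing x y with
  | zero => simp
  | succ i ih =>
    rw [pow_succ', Module.End.mul_apply, hT, ih, ← Module.End.mul_apply, ← pow_succ, pow_succ']

theorem inner_pow_add_apply {T : E →ₗ[ℝ] E} (hT : T.IsSymmetric) (i j : ℕ) (x y : E) :
    ⟪(T ^ (i + j)) x, y⟫ = ⟪(T ^ i) x, (T ^ j) y⟫ := by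
  rw [add_comm, pow_add, Module.End.mul_apply, inner_pow_apply_left hT]

/-- Even moments are squared norms; odd ones are the form of `T` at an iterate. -/
theorem inner_pow_apply_self_nonneg {T : E →ₗ[ℝ] E} (hT : T.IsPositive) (j : ℕ) (x : E) :
    0 ≤ ⟪(T ^ j) x, x⟫ := by
  obtain ⟨i, rfl | rfl⟩ := j.even_or_odd'
  · rw [two_mul, inner_pow_add_apply hT.isSymmetric]
    exact real_inner_self_nonneg
  · rw [show 2 * i + 1 = (i + 1) + i by ring, inner_pow_add_apply hT.isSymmetric, pow_succ']
    exact hT.re_inner_nonneg_left _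

/-- The moments `⟪T ^ j x, x⟫` of a positive operator are log-convex. -/
theorem inner_pow_apply_self_logConvex {T : E →ₗ[ℝ] E} (hT : T.IsPositive) (j : ℕ) (x : E) :
    ⟪(T ^ (j + 1)) x, x⟫ ^ 2 ≤ ⟪(T ^ j) x, x⟫ * ⟪(T ^ (j + 2)) x, x⟫ := by
  have hs := hT.isSymmetric
  -- Cauchy–Schwarz for the semidefinite form `⟪T ^ j ·, ·⟫` at `x` and `T x`.
  have h := LinearMap.BilinForm.apply_mul_apply_le_of_forall_zero_le
    ((innerₗ E).comp (T ^ j)) (fun y => inner_pow_apply_self_nonneg hT j y) x (T x)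
  have e1 : ⟪(T ^ j) x, T x⟫ = ⟪(T ^ (j + 1)) x, x⟫ := by
    rw [inner_pow_add_apply hs, pow_one]
  have e2 : ⟪(T ^ j) (T x), x⟫ = ⟪(T ^ (j + 1)) x, x⟫ := by
    rw [pow_succ, Module.End.mul_apply]
  have e3 : ⟪(T ^ j) (T x), T x⟫ = ⟪(T ^ (j + 2)) x, x⟫ := by
    rw [show j + 2 = (j + 1) + 1 by ring, inner_pow_add_apply hs (j + 1) 1, pow_one,
      pow_succ, Module.End.mul_apply]
  simp only [LinearMap.comp_apply, innerₗ_apply_apply, e1, e2, e3] at h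
  rw [sq]
  exact h

/-- Power iteration with a positive operator: if the starting vector `z` has a component of at
least `exp (-Λ / 2) * ‖z‖` along an eigenvector for the eigenvalue `μ`, then the Rayleigh quotient
after `n` steps is at least `μ * (1 - Λ / (2 * n))`. -/
theorem rayleigh_power_iterate_ge {T : E →ₗ[ℝ] E} (hT : T.IsPositive) {u z : E} {μ Λ : ℝ}
    (hμ : 0 < μ) (hu : T u = μ • u) (hu1 : ‖u‖ = 1) (hz : z ≠ 0)
    (hq : Real.exp (-Λ) * ‖z‖ ^ 2 ≤ ⟪u, z⟫ ^ 2) {n : ℕ} (hn : 0 < n) :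
    (T ^ n) z ≠ 0 ∧
      μ * (1 - Λ / (2 * n)) * ‖(T ^ n) z‖ ^ 2 ≤ ⟪T ((T ^ n) z), (T ^ n) z⟫ := by
  have hs := hT.isSymmetric
  have hz2 : 0 < ‖z‖ ^ 2 := by positivity
  have huz : ⟪u, z⟫ ^ 2 > 0 := lt_of_lt_of_le (by positivity) hq
  have hTu : ∀ i : ℕ, (T ^ i) u = μ ^ i • u := by
    intro i
    induction i with
    | zero => simp
    | succ i ih => rw [pow_succ', Module.End.mul_apply, ih, map_smul, hu, smul_smul, pow_succ]
  have hcs : ∀ i : ℕ, (μ ^ i) ^ 2 * ⟪u, z⟫ ^ 2 ≤ ‖(T ^ i) z‖ ^ 2 := by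
    intro i
    have h1 : ⟪u, (T ^ i) z⟫ = μ ^ i * ⟪u, z⟫ := by
      rw [← inner_pow_apply_left hs, hTu, real_inner_smul_left]
    have h2 := abs_real_inner_le_norm u ((T ^ i) z)
    rw [hu1, one_mul, h1] at h2
    rw [← mul_pow, ← sq_abs]
    exact pow_le_pow_left₀ (abs_nonneg _) h2 2
  set a : ℕ → ℝ := fun j => ⟪(T ^ j) z, z⟫ with ha
  have heven : ∀ i, a (i + i) = ‖(T ^ i) z‖ ^ 2 := fun i => by
    simp only [ha]; rw [inner_pow_add_apply hs, real_inner_self_eq_norm_sq]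
  have hevenpos : ∀ i, 0 < a (i + i) := fun i => by
    rw [heven]; exact lt_of_lt_of_le (by positivity) (hcs i)
  have hconv : ∀ j, a (j + 1) ^ 2 ≤ a j * a (j + 2) := fun j =>
    inner_pow_apply_self_logConvex hT j z
  have hpos : ∀ j, 0 < a j := by
    intro j
    obtain ⟨i, rfl | rfl⟩ := j.even_or_odd'
    · rw [two_mul]; exact hevenpos i
    -- A vanishing odd moment would, by log-convexity, make the next even moment vanish.
    · refine lt_of_le_of_ne (inner_pow_apply_self_nonneg hT _ z) fun h0 => ?_
      have h1 := hconv (2 * i + 1)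
      rw [← h0, zero_mul] at h1
      have h2 := hevenpos (i + 1)
      rw [show i + 1 + (i + 1) = 2 * i + 1 + 1 by ring] at h2
      nlinarith
  have hodd : a (n + n + 1) = ⟪T ((T ^ n) z), (T ^ n) z⟫ := by
    simp only [ha]
    rw [show n + n + 1 = (n + 1) + n by ring, inner_pow_add_apply hs, pow_succ',
      Module.End.mul_apply]
  have hn0 := hevenpos n
  refine ⟨fun h0 => ?_, ?_⟩
  · rw [heven, h0] at hn0; simp at hn0
  rw [← heven, ← hodd]
  by_contra! hlt
  -- `ρ` is the Rayleigh quotient after `n` steps. Log-convexity gives `a (2n) ≤ ρ ^ (2n) * ‖z‖²`,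
  -- while the component along `u` gives `a (2n) ≥ μ ^ (2n) * exp (-Λ) * ‖z‖²`; a small `ρ`
  -- contradicts this.
  set ρ := a (n + n + 1) / a (n + n) with hρ
  have hρ0 : 0 < ρ := div_pos (hpos _) (hpos _)
  have hρlt : ρ < μ * (1 - Λ / (2 * n)) := by
    rw [hρ, div_lt_iff₀ hn0]; exact hlt
  have hbound := le_ratio_pow_mul_of_logConvex hpos hconv (n + n)
  rw [← hρ] at hbound
  have ha0 : a 0 = ‖z‖ ^ 2 := by simp [ha]
  have hnR : (0 : ℝ) < n := by exact_mod_cast hn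
  have hexp : (μ * (1 - Λ / (2 * n))) ^ (n + n) ≤ μ ^ (n + n) * Real.exp (-Λ) := by
    rw [mul_pow]
    refine mul_le_mul_of_nonneg_left ?_ (by positivity)
    have hnn : 0 ≤ 1 - Λ / (2 * n) := by
      by_contra! hneg
      nlinarith
    calc (1 - Λ / (2 * n)) ^ (n + n) ≤ Real.exp (-(Λ / (2 * n))) ^ (n + n) :=
          pow_le_pow_left₀ hnn (Real.one_sub_le_exp_neg _) _
      _ = Real.exp (-Λ) := by
          rw [← Real.exp_nat_mul]
          congr 1
          push_cast
          field_simp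
          ring
  have hstrict : ρ ^ (n + n) < (μ * (1 - Λ / (2 * n))) ^ (n + n) :=
    pow_lt_pow_left₀ hρlt hρ0.le (by omega)
  have h1 := hcs n
  rw [← heven] at h1
  have h2 : ρ ^ (n + n) * ‖z‖ ^ 2 < μ ^ (n + n) * Real.exp (-Λ) * ‖z‖ ^ 2 :=
    mul_lt_mul_of_pos_right (hstrict.trans_le hexp) hz2
  have h3 : μ ^ (n + n) * (Real.exp (-Λ) * ‖z‖ ^ 2) ≤ μ ^ (n + n) * ⟪u, z⟫ ^ 2 :=
    mul_le_mul_of_nonneg_left hq (by positivity)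
  have h4 : (μ ^ n) ^ 2 = μ ^ (n + n) := by ring
  rw [h4] at h1
  rw [ha0] at hbound
  linarith

/-- A symmetric operator on a nontrivial finite-dimensional space has a unit eigenvector whose
eigenvalue bounds all Rayleigh quotients. -/
theorem exists_unit_eigenvector_ge [FiniteDimensional ℝ E] [Nontrivial E] {T : E →ₗ[ℝ] E}
    (hT : T.IsSymmetric) :
    ∃ (μ : ℝ) (u : E), ‖u‖ = 1 ∧ T u = μ • u ∧ ∀ x, ⟪T x, x⟫ ≤ μ * ‖x‖ ^ 2 := by
  have hev := hT.hasEigenvalue_iSup_of_finiteDimensional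
  obtain ⟨v, hv⟩ := hev.exists_hasEigenvector
  have hv0 : ‖v‖ ≠ 0 := norm_ne_zero_iff.2 hv.2
  refine ⟨⨆ x : {x : E // x ≠ 0}, RCLike.re ⟪T x, x⟫ / ‖(x : E)‖ ^ 2, ‖v‖⁻¹ • v, by simp [norm_smul, hv0], ?_, fun x => ?_⟩
  · rw [map_smul, hv.apply_eq_smul, smul_comm]; rfl
  · rcases eq_or_ne x 0 with rfl | hx
    · simp
    have hx2 : 0 < ‖x‖ ^ 2 := by positivity
    rw [← div_le_iff₀ hx2]
    refine le_ciSup (f := fun x : {x : E // x ≠ 0} => RCLike.re ⟪T x, x⟫ / ‖(x : E)‖ ^ 2)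
      ⟨‖LinearMap.toContinuousLinearMap T‖, ?_⟩ ⟨x, hx⟩
    rintro _ ⟨y, rfl⟩
    have hy : 0 < ‖(y : E)‖ := norm_pos_iff.2 y.2
    simp only [RCLike.re_to_real]
    rw [div_le_iff₀ (by positivity)]
    have h1 := real_inner_le_norm (T y) y
    have h2 := (LinearMap.toContinuousLinearMap T).le_opNorm (y : E)
    simp only [LinearMap.coe_toContinuousLinearMap'] at h2
    nlinarith

end PowerIteration

/-! ### Gaussian estimates -/

/-- The density is at most `1 / √(2π) ≤ 1 / 2`, and the interval has length `2a`. -/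
theorem gaussianReal_Icc_le (a : ℝ) :
    gaussianReal 0 1 (Set.Icc (-a) a) ≤ ENNReal.ofReal a := by
  rw [gaussianReal_apply 0 one_ne_zero]
  calc ∫⁻ x in Set.Icc (-a) a, gaussianPDF 0 1 x
      ≤ ∫⁻ _ in Set.Icc (-a) a, ENNReal.ofReal (1 / 2) := by
        refine lintegral_mono fun x => ENNReal.ofReal_le_ofReal ?_
        have hsqrt : 2 ≤ √(2 * Real.pi * (1 : NNReal)) := by
          refine Real.le_sqrt_of_sq_le ?_
          push_cast
          nlinarith [Real.pi_gt_three]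
        rw [gaussianPDFReal]
        calc _ ≤ (√(2 * Real.pi * (1 : NNReal)))⁻¹ * 1 := by
              refine mul_le_mul_of_nonneg_left (Real.exp_le_one_iff.2 ?_) (by positivity)
              have : 0 ≤ (x - 0) ^ 2 / (2 * ((1 : NNReal) : ℝ)) := by positivity
              rw [neg_div]; linarith
          _ ≤ 1 / 2 := by
              rw [mul_one, one_div]
              exact inv_anti₀ two_pos hsqrt
    _ = ENNReal.ofReal a := by
        rw [setLIntegral_const, Real.volume_Icc, ← ENNReal.ofReal_mul (by norm_num)]
        congr 1; ring

section Gaussian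

variable {E : Type*} [NormedAddCommGroup E] [InnerProductSpace ℝ E] [FiniteDimensional ℝ E]
  [MeasurableSpace E] [BorelSpace E]

theorem stdGaussian_map_inner {u : E} (hu : ‖u‖ = 1) :
    (stdGaussian E).map (fun x => ⟪u, x⟫) = gaussianReal 0 1 := by
  have h := IsGaussian.map_eq_gaussianReal (μ := stdGaussian E) (innerSL ℝ u)
  rw [integral_strongDual_stdGaussian, variance_dual_stdGaussian, innerSL_apply_norm, hu] at h
  simpa using h

theorem stdGaussian_abs_inner_le {u : E} (hu : ‖u‖ = 1) (a : ℝ) :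
    stdGaussian E {x | |⟪u, x⟫| ≤ a} ≤ ENNReal.ofReal a := by
  have h := gaussianReal_Icc_le a
  rw [← stdGaussian_map_inner hu, Measure.map_apply (by fun_prop) measurableSet_Icc] at h
  simpa [Set.preimage, abs_le] using h

theorem lintegral_inner_sq_stdGaussian {u : E} (hu : ‖u‖ = 1) :
    ∫⁻ x, ENNReal.ofReal (⟪u, x⟫ ^ 2) ∂(stdGaussian E) = 1 := by
  have h1 : ∫⁻ y, ENNReal.ofReal (y ^ 2) ∂(gaussianReal 0 1) = 1 := by
    have hv := variance_id_gaussianReal (μ := 0) (v := 1)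
    have he := evariance_eq_lintegral_ofReal id (gaussianReal 0 1)
    simp only [id_eq, integral_id_gaussianReal, sub_zero] at he
    rw [← he, ← ((memLp_id_gaussianReal 2).ofReal_variance_eq)]
    simp
  rw [← stdGaussian_map_inner hu, lintegral_map (by fun_prop) (by fun_prop)] at h1
  exact h1

theorem lintegral_norm_sq_stdGaussian :
    ∫⁻ x, ENNReal.ofReal (‖x‖ ^ 2) ∂(stdGaussian E) = Module.finrank ℝ E := by
  have h : ∀ x : E, ENNReal.ofReal (‖x‖ ^ 2) =
      ∑ i, ENNReal.ofReal (⟪stdOrthonormalBasis ℝ E i, x⟫ ^ 2) := fun x => by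
    rw [← ENNReal.ofReal_sum_of_nonneg fun _ _ => sq_nonneg _,
      (stdOrthonormalBasis ℝ E).sum_sq_inner_right]
  simp_rw [h]
  rw [lintegral_finsetSum _ fun i _ => by fun_prop]
  simp [lintegral_inner_sq_stdGaussian]

/-- Markov's inequality for the second moment. -/
theorem stdGaussian_norm_sq_ge_le {b : ℝ} (hb : 0 < b) :
    stdGaussian E {x | b ≤ ‖x‖ ^ 2} ≤ ENNReal.ofReal (Module.finrank ℝ E / b) := by
  have h := meas_ge_le_lintegral_div (μ := stdGaussian E)
    (f := fun x : E => ENNReal.ofReal (‖x‖ ^ 2)) (by fun_prop)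
    (ε := ENNReal.ofReal b) (by simpa using hb) (by simp)
  rw [lintegral_norm_sq_stdGaussian] at h
  rw [ENNReal.ofReal_div_of_pos hb, ENNReal.ofReal_natCast]
  refine (measure_mono fun x hx => ?_).trans h
  exact ENNReal.ofReal_le_ofReal hx

/-- With probability at least `1 - ξ / d`, a standard Gaussian vector in dimension `d` has a
component of relative size at least `(ξ / (2 d)) ^ 2` in a given direction. -/
theorem stdGaussian_small_component_le {u : E} (hu : ‖u‖ = 1) {ξ : ℝ} (hξ : 0 < ξ) (hξ1 : ξ ≤ 1)
    (hd : 0 < Module.finrank ℝ E) :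
    stdGaussian E {x | ¬ ((ξ / (2 * Module.finrank ℝ E)) ^ 4 * ‖x‖ ^ 2 ≤ ⟪u, x⟫ ^ 2 ∧
      ⟪u, x⟫ ≠ 0)} ≤ ENNReal.ofReal (ξ / Module.finrank ℝ E) := by
  set d : ℝ := (Module.finrank ℝ E : ℝ) with hdd
  have hd0 : 0 < d := by rw [hdd]; exact_mod_cast hd
  have hd1 : 1 ≤ d := by rw [hdd]; exact_mod_cast hd
  have hb : 0 < 2 * d ^ 2 / ξ := by positivity
  -- Both thresholds are chosen so that each exceptional event has probability at most `ξ / (2 d)`.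
  have hsub : {x : E | ¬ ((ξ / (2 * d)) ^ 4 * ‖x‖ ^ 2 ≤ ⟪u, x⟫ ^ 2 ∧ ⟪u, x⟫ ≠ 0)} ⊆
      {x | |⟪u, x⟫| ≤ ξ / (2 * d)} ∪ {x | 2 * d ^ 2 / ξ ≤ ‖x‖ ^ 2} := by
    intro x hx
    by_contra hc
    simp only [Set.mem_union, Set.mem_ofPred_eq, not_or, not_le] at hc
    obtain ⟨h1, h2⟩ := hc
    have hp : 0 < ξ / (2 * d) := by positivity
    refine hx ⟨?_, abs_pos.1 (hp.trans h1)⟩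
    have h3 : (ξ / (2 * d)) ^ 2 ≤ ⟪u, x⟫ ^ 2 := by
      rw [← sq_abs ⟪u, x⟫]; exact pow_le_pow_left₀ hp.le h1.le 2
    refine le_trans ?_ h3
    have h4 : (ξ / (2 * d)) ^ 2 * ‖x‖ ^ 2 ≤ 1 := by
      calc (ξ / (2 * d)) ^ 2 * ‖x‖ ^ 2 ≤ (ξ / (2 * d)) ^ 2 * (2 * d ^ 2 / ξ) := by gcongr
        _ = ξ / 2 := by field_simp
        _ ≤ 1 := by linarith
    calc (ξ / (2 * d)) ^ 4 * ‖x‖ ^ 2 = (ξ / (2 * d)) ^ 2 * ((ξ / (2 * d)) ^ 2 * ‖x‖ ^ 2) := by ring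
      _ ≤ (ξ / (2 * d)) ^ 2 * 1 := by gcongr
      _ = _ := mul_one _
  refine (measure_mono hsub).trans ((measure_union_le _ _).trans ?_)
  refine (add_le_add (stdGaussian_abs_inner_le hu _) (stdGaussian_norm_sq_ge_le hb)).trans ?_
  rw [← ENNReal.ofReal_add (by positivity) (by positivity)]
  refine ENNReal.ofReal_le_ofReal (le_of_eq ?_)
  rw [← hdd]
  field_simp
  norm_num

end Gaussian

/-! ### The quadratic form -/

section Quadratic

variable {d : ℕ} {M : Matrix (Fin d) (Fin d) ℝ}

theorem quadForm_eq_inner (x : Euc d) :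
    quadForm M x = (1 / 2) * ⟪Matrix.toEuclideanCLM (𝕜 := ℝ) M x, x⟫ := by
  rw [quadForm, real_inner_comm, Matrix.inner_toEuclideanCLM]

theorem toEuclideanCLM_isSymmetric (hM : M.IsHermitian) :
    (Matrix.toEuclideanCLM (𝕜 := ℝ) M).toLinearMap.IsSymmetric :=
  Matrix.isSymmetric_toEuclideanLin_iff.2 hM

theorem abs_inner_toEuclideanCLM_le (hM : M.IsHermitian) (x : Euc d) :
    |⟪Matrix.toEuclideanCLM (𝕜 := ℝ) M x, x⟫| ≤ lambdaAbsMax hM * ‖x‖ ^ 2 := by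
  set b := hM.eigenvectorBasis with hb
  have hs := toEuclideanCLM_isSymmetric hM
  have h1 : ∀ i, ⟪Matrix.toEuclideanCLM (𝕜 := ℝ) M x, b i⟫ = hM.eigenvalues i * ⟪x, b i⟫ := by
    intro i
    have h2 : Matrix.toEuclideanCLM (𝕜 := ℝ) M (b i) = hM.eigenvalues i • b i := by
      apply WithLp.ofLp_injective
      exact hM.mulVec_eigenvectorBasis i
    have h3 := hs x (b i)
    simp only [ContinuousLinearMap.coe_coe] at h3
    rw [h3, h2, real_inner_smul_right]
  rw [← b.sum_inner_mul_inner]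
  calc |∑ i, ⟪Matrix.toEuclideanCLM (𝕜 := ℝ) M x, b i⟫ * ⟪b i, x⟫|
      ≤ ∑ i, |⟪Matrix.toEuclideanCLM (𝕜 := ℝ) M x, b i⟫ * ⟪b i, x⟫| :=
        Finset.abs_sum_le_sum_abs _ _
    _ ≤ ∑ i, lambdaAbsMax hM * ⟪b i, x⟫ ^ 2 := by
        refine Finset.sum_le_sum fun i _ => ?_
        rw [h1, real_inner_comm x, mul_assoc, ← sq, abs_mul, abs_sq]
        refine mul_le_mul_of_nonneg_right ?_ (sq_nonneg _)
        exact le_ciSup (f := fun i => |hM.eigenvalues i|) (Set.finite_range _).bddAbove i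
    _ = _ := by rw [← Finset.mul_sum, b.sum_sq_inner_right]

theorem gradient_quadForm (hM : M.IsHermitian) (x : Euc d) :
    gradient (quadForm M) x = Matrix.toEuclideanCLM (𝕜 := ℝ) M x := by
  set m := Matrix.toEuclideanCLM (𝕜 := ℝ) M with hm
  refine HasGradientAt.gradient ?_
  rw [hasGradientAt_iff_hasFDerivAt]
  have h := ((m.hasFDerivAt (x := x)).inner ℝ (hasFDerivAt_id x)).const_mul (1 / 2 : ℝ)
  have hf : quadForm M = fun y => (1 / 2 : ℝ) * ⟪m y, id y⟫ := funext fun y => quadForm_eq_inner y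
  rw [hf]
  refine h.congr_fderiv ?_
  ext y
  have hs := toEuclideanCLM_isSymmetric hM y x
  simp only [ContinuousLinearMap.coe_coe, ← hm] at hs
  simp [hs, real_inner_comm]
  ring

theorem quadForm_zero : quadForm M 0 = 0 := by simp [quadForm]

theorem quadForm_neg (x : Euc d) : quadForm M (-x) = quadForm M x := by
  simp [quadForm_eq_inner]

end Quadratic

/-! ### Programs -/

namespace OracleProg

variable {d : ℕ} {α β : Type} (f : Euc d → ℝ)

theorem eval_bind (p : OracleProg (Euc d) α) (q : α → OracleProg (Euc d) β) :
    (p.bind q).eval f = (q (p.eval f)).eval f := by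
  induction p with
  | ret a => rfl
  | grad x next ih => exact ih _
  | value x next ih => exact ih _

theorem gradCalls_bind (p : OracleProg (Euc d) α) (q : α → OracleProg (Euc d) β) :
    (p.bind q).gradCalls f = p.gradCalls f + (q (p.eval f)).gradCalls f := by
  induction p with
  | ret a => simp [bind, gradCalls, eval]
  | grad x next ih => simp only [bind, gradCalls, eval, ih]; omega
  | value x next ih => simp only [bind, gradCalls, eval, ih]

end OracleProg

/-! ### Oracle counts, and the algorithm as iteration of a linear operator -/

section Algorithm

variable {d k : ℕ}

theorem gradCalls_powerLoop (f : Euc d → ℝ) (x : Euc d) (𝒜 : AffineSubspace ℝ (Euc d))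
    [Nonempty 𝒜] (η : ℝ) (T : ℕ) (z : Euc d) :
    (powerLoop x 𝒜 η T z).gradCalls f = 2 * T := by
  induction T generalizing z with
  | zero => rfl
  | succ T ih => simp only [powerLoop, OracleProg.gradCalls, ih]; ring

theorem gradCalls_houdiniEscapeCorner_le (f : Euc d → ℝ) (x : Euc d)
    (A : Matrix (Fin k) (Fin d) ℝ) (δ r η : ℝ) (T : ℕ) (noise : Finset (Fin k) → Euc d)
    (l : List (Finset (Fin k))) :
    (houdiniEscapeCorner x A δ r η T noise l).gradCalls f ≤ 2 * T * l.length := by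
  induction l with
  | nil => simp [houdiniEscapeCorner, OracleProg.gradCalls]
  | cons I rest ih =>
    have h : ∀ e : Euc d, (findInsideCorner x (activeSubspace A x I) r η T e).gradCalls f
        = 2 * T := fun e => by
      simp [findInsideCorner, OracleProg.gradCalls_bind, gradCalls_powerLoop, OracleProg.gradCalls]
    simp only [houdiniEscapeCorner, OracleProg.gradCalls_bind, h, OracleProg.gradCalls,
      List.length_cons]
    rw [mul_add, mul_one]
    split_ifs
    · simp only [OracleProg.gradCalls]; omega
    · simp only [OracleProg.gradCalls]
      split_ifs
      · simp only [OracleProg.gradCalls]; omega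
      · omega

/-- The point `e` lies in the cone and improves the value by more than `δ / 2`. -/
def IsEscape (f : Euc d → ℝ) (A : Matrix (Fin k) (Fin d) ℝ) (δ : ℝ) (e : Euc d) : Prop :=
  e ∈ cornerCone A 0 ∧ f e < f 0 - δ / 2

theorem norm_findInsideCorner_eval_le (f : Euc d → ℝ) (𝒜 : AffineSubspace ℝ (Euc d))
    [Nonempty 𝒜] {r : ℝ} (hr : 0 < r) (η : ℝ) (T : ℕ) (ζ : Euc d) :
    ‖(findInsideCorner 0 𝒜 r η T ζ).eval f‖ ≤ r := by
  simp only [findInsideCorner, OracleProg.eval_bind, OracleProg.eval, norm_smul, sub_zero]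
  set w := (powerLoop 0 𝒜 η T (proj 𝒜 (0 + ζ))).eval f
  rcases eq_or_ne w 0 with hw | hw
  · simp [hw, hr.le]
  · have : 0 < ‖w‖ := norm_pos_iff.2 hw
    rw [norm_div, norm_norm, div_mul_cancel₀ _ this.ne', Real.norm_of_nonneg hr.le]

/-- The search succeeds if one of the candidates does. -/
theorem houdiniEscapeCorner_eval_of_isEscape (f : Euc d → ℝ) (A : Matrix (Fin k) (Fin d) ℝ)
    {δ r : ℝ} (hr : 0 < r) (η : ℝ) (T : ℕ) (noise : Finset (Fin k) → Euc d)
    (l : List (Finset (Fin k)))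
    (h : ∃ I ∈ l,
      IsEscape f A δ ((findInsideCorner 0 (activeSubspace A 0 I) r η T (noise I)).eval f) ∨
      IsEscape f A δ (-(findInsideCorner 0 (activeSubspace A 0 I) r η T (noise I)).eval f)) :
    ∃ y ∈ cornerCone A 0 ∩ Metric.closedBall (0 : Euc d) r,
      (houdiniEscapeCorner 0 A δ r η T noise l).eval f = some y ∧ f y < f 0 - δ / 2 := by
  induction l with
  | nil => simp at h
  | cons I rest ih =>
    have hnorm := norm_findInsideCorner_eval_le f (activeSubspace A 0 I) hr η T (noise I)
    simp only [houdiniEscapeCorner, OracleProg.eval_bind, OracleProg.eval]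
    simp only [List.mem_cons, exists_eq_or_imp] at h
    set e := (findInsideCorner 0 (activeSubspace A 0 I) r η T (noise I)).eval f with he
    by_cases h1 : 0 + e ∈ cornerCone A 0 ∧ f (0 + e) < f 0 - δ / 2
    · rw [if_pos h1]
      exact ⟨0 + e, ⟨h1.1, by simpa using hnorm⟩, rfl, h1.2⟩
    · rw [if_neg h1]
      simp only [OracleProg.eval]
      by_cases h2 : 0 - e ∈ cornerCone A 0 ∧ f (0 - e) < f 0 - δ / 2
      · rw [if_pos h2]
        exact ⟨0 - e, ⟨h2.1, by simpa using hnorm⟩, rfl, h2.2⟩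
      · rw [if_neg h2]
        refine ih (h.resolve_left ?_)
        rintro (h3 | h3)
        · exact h1 (by simpa [IsEscape] using h3)
        · exact h2 (by simpa [IsEscape] using h3)

/-- The operator that one step of the projected power method applies. -/
noncomputable def stepOp (M : Matrix (Fin d) (Fin d) ℝ) (η : ℝ) (V : Submodule ℝ (Euc d)) :
    Euc d →L[ℝ] Euc d :=
  V.starProjection ∘L (1 - η • Matrix.toEuclideanCLM (𝕜 := ℝ) M) ∘L V.starProjection

theorem proj_mk'_zero (V : Submodule ℝ (Euc d)) (z : Euc d) :
    proj (AffineSubspace.mk' 0 V) z = V.starProjection z := by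
  rw [proj, EuclideanGeometry.coe_orthogonalProjection_eq_iff_mem]
  refine ⟨?_, ?_⟩
  · simp [AffineSubspace.mem_mk']
  · rw [AffineSubspace.direction_mk', vsub_eq_sub]
    exact V.sub_starProjection_mem_orthogonal z

theorem stepOp_mem (M : Matrix (Fin d) (Fin d) ℝ) (η : ℝ) (V : Submodule ℝ (Euc d)) (z : Euc d) :
    stepOp M η V z ∈ V :=
  V.starProjection_apply_mem _

/-- The iterates stay in `V`, so the inner projection in `stepOp` does not affect them; it makes the
operator symmetric on the whole space. -/
theorem powerLoop_eval {M : Matrix (Fin d) (Fin d) ℝ} (hM : M.IsHermitian) (η : ℝ)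
    (V : Submodule ℝ (Euc d)) (T : ℕ) {z : Euc d} (hz : z ∈ V) :
    (powerLoop 0 (AffineSubspace.mk' 0 V) η T z).eval (quadForm M) =
      ((stepOp M η V).toLinearMap ^ T) z := by
  induction T generalizing z with
  | zero => rfl
  | succ T ih =>
    have h : proj (AffineSubspace.mk' 0 V)
        (z - η • (gradient (quadForm M) z - gradient (quadForm M) 0)) = stepOp M η V z := by
      simp [proj_mk'_zero, gradient_quadForm hM, stepOp, V.starProjection_eq_self_iff.2 hz]
    simp only [powerLoop, OracleProg.eval]
    rw [h, ih (stepOp_mem M η V z), pow_succ, Module.End.mul_apply]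
    rfl

theorem findInsideCorner_eval {M : Matrix (Fin d) (Fin d) ℝ} (hM : M.IsHermitian) (r η : ℝ)
    (V : Submodule ℝ (Euc d)) (T : ℕ) (ζ : Euc d) :
    (findInsideCorner 0 (AffineSubspace.mk' 0 V) r η T ζ).eval (quadForm M) =
      (r / ‖((stepOp M η V).toLinearMap ^ T) (V.starProjection ζ)‖) •
        ((stepOp M η V).toLinearMap ^ T) (V.starProjection ζ) := by
  simp only [findInsideCorner, OracleProg.eval_bind, OracleProg.eval, zero_add, sub_zero,
    proj_mk'_zero]
  rw [powerLoop_eval hM η V T (by simp)]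

theorem pow_stepOp_mem (M : Matrix (Fin d) (Fin d) ℝ) (η : ℝ) (V : Submodule ℝ (Euc d)) (T : ℕ)
    {z : Euc d} (hz : z ∈ V) : ((stepOp M η V).toLinearMap ^ T) z ∈ V := by
  induction T with
  | zero => exact hz
  | succ T ih => rw [pow_succ', Module.End.mul_apply]; exact stepOp_mem M η V _

/-- The step size `1 / L` makes `1 - M / L` positive semidefinite, and compression to `V` preserves
this. -/
theorem stepOp_isPositive {M : Matrix (Fin d) (Fin d) ℝ} (hM : M.IsHermitian) {L : ℝ}
    (hL : 0 < L) (hML : lambdaAbsMax hM ≤ L) (V : Submodule ℝ (Euc d)) :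
    (stepOp M (1 / L) V).toLinearMap.IsPositive := by
  have hs := toEuclideanCLM_isSymmetric hM
  refine ContinuousLinearMap.IsPositive.conj_starProjection V ?_
  refine ⟨fun x y => ?_, fun x => ?_⟩
  · have := hs x y
    simp only [ContinuousLinearMap.coe_coe] at this
    simp [inner_sub_left, inner_sub_right, real_inner_smul_left, real_inner_smul_right, this]
  · have h := (le_abs_self _).trans (abs_inner_toEuclideanCLM_le hM x)
    have h2 := mul_le_mul_of_nonneg_right hML (sq_nonneg ‖x‖)
    have h3 : 1 / L * ⟪Matrix.toEuclideanCLM (𝕜 := ℝ) M x, x⟫ ≤ ‖x‖ ^ 2 := by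
      rw [one_div, inv_mul_le_iff₀ hL]; linarith
    simp only [ContinuousLinearMap.reApplyInnerSelf]
    simp [inner_sub_left, real_inner_smul_left] at h3 ⊢
    exact h3

/-- Translates between Rayleigh quotients of the step operator and values of `f`: large quotients
mean negative values. -/
theorem inner_stepOp_of_mem (M : Matrix (Fin d) (Fin d) ℝ) (η : ℝ) (V : Submodule ℝ (Euc d))
    {x : Euc d} (hx : x ∈ V) :
    ⟪stepOp M η V x, x⟫ = ‖x‖ ^ 2 - 2 * η * quadForm M x := by
  have h1 : V.starProjection x = x := V.starProjection_eq_self_iff.2 hx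
  simp only [stepOp, ContinuousLinearMap.comp_apply]
  rw [V.inner_starProjection_left_eq_right, h1, quadForm_eq_inner]
  simp [inner_sub_left, real_inner_smul_left]
  ring

end Algorithm

/-! ### Geometry of the faces of the cone -/

section Geometry

variable {d k : ℕ}

theorem mem_cornerCone_zero {A : Matrix (Fin k) (Fin d) ℝ} {x : Euc d} :
    x ∈ cornerCone A 0 ↔ ∀ i, A.mulVec x.ofLp i ≤ 0 := by
  simp [cornerCone]

theorem mulVec_lineMap (A : Matrix (Fin k) (Fin d) ℝ) (a b : ℝ) (x w : Euc d) (i : Fin k) :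
    A.mulVec (a • x + b • w).ofLp i = a * A.mulVec x.ofLp i + b * A.mulVec w.ofLp i := by
  simp [Matrix.mulVec_add, Matrix.mulVec_smul]

/-- A segment that leaves the cone does so through one of the facets. -/
theorem exists_facet_crossing {A : Matrix (Fin k) (Fin d) ℝ} {x w : Euc d}
    (hx : x ∈ cornerCone A 0) (hw : w ∉ cornerCone A 0) :
    ∃ s : ℝ, 0 ≤ s ∧ s ≤ 1 ∧ ∃ i, 0 < A.mulVec w.ofLp i ∧
      (1 - s) • x + s • w ∈ cornerCone A 0 ∧ A.mulVec ((1 - s) • x + s • w).ofLp i = 0 := by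
  rw [mem_cornerCone_zero] at hx hw
  push Not at hw
  set p : Fin k → ℝ := fun i => A.mulVec x.ofLp i with hp
  set q : Fin k → ℝ := fun i => A.mulVec w.ofLp i with hq
  have hx' : ∀ i, p i ≤ 0 := hx
  obtain ⟨i₀, hi₀⟩ := hw
  -- Among the constraints violated at `w`, take the one that becomes active first along the
  -- segment.
  obtain ⟨i, hi, hmin⟩ := Finset.exists_min_image (Finset.univ.filter fun i => 0 < q i)
    (fun i => -p i / (q i - p i)) ⟨i₀, by simpa using hi₀⟩
  have hqi : 0 < q i := by simpa using hi
  have hden : 0 < q i - p i := by linarith [hx' i]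
  set s := -p i / (q i - p i) with hs
  have hs0 : 0 ≤ s := div_nonneg (by linarith [hx' i]) hden.le
  have hs1 : s ≤ 1 := by rw [hs, div_le_one hden]; linarith
  refine ⟨s, hs0, hs1, i, hqi, ?_, ?_⟩
  · rw [mem_cornerCone_zero]
    intro j
    rw [mulVec_lineMap]
    change (1 - s) * p j + s * q j ≤ 0
    by_cases hj : 0 < q j
    · have h1 := hmin j (by simpa using hj)
      have hdj : 0 < q j - p j := by linarith [hx' j]
      rw [le_div_iff₀ hdj] at h1
      linarith
    · push Not at hj
      have h1 := mul_nonpos_of_nonneg_of_nonpos hs0 hj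
      have h2 := mul_nonpos_of_nonneg_of_nonpos (sub_nonneg.2 hs1) (hx' j)
      linarith
  · rw [mulVec_lineMap]
    change (1 - s) * p i + s * q i = 0
    rw [hs]
    field_simp
    ring

theorem quadForm_smul_add_smul {M : Matrix (Fin d) (Fin d) ℝ} (hM : M.IsHermitian) (a b : ℝ)
    (x w : Euc d) :
    quadForm M (a • x + b • w) = a ^ 2 * quadForm M x + b ^ 2 * quadForm M w +
      a * b * ⟪Matrix.toEuclideanCLM (𝕜 := ℝ) M x, w⟫ := by
  have hs := toEuclideanCLM_isSymmetric hM x w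
  simp only [ContinuousLinearMap.coe_coe] at hs
  have h : ⟪Matrix.toEuclideanCLM (𝕜 := ℝ) M w, x⟫ = ⟪Matrix.toEuclideanCLM (𝕜 := ℝ) M x, w⟫ := by
    rw [hs, real_inner_comm]
  simp only [quadForm_eq_inner, map_add, map_smul, inner_add_left, inner_add_right,
    real_inner_smul_left, real_inner_smul_right, h]
  ring

theorem norm_sq_smul_add_smul (a b : ℝ) (x w : Euc d) :
    ‖a • x + b • w‖ ^ 2 = a ^ 2 * ‖x‖ ^ 2 + b ^ 2 * ‖w‖ ^ 2 + 2 * (a * b * ⟪x, w⟫) := by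
  rw [norm_add_sq_real, norm_smul, norm_smul, mul_pow, mul_pow, Real.norm_eq_abs, Real.norm_eq_abs,
    sq_abs, sq_abs, real_inner_smul_left, real_inner_smul_right]
  ring

/-- If `x` lies in the cone, neither `e` nor `-e` does, and the Rayleigh quotient of `f` at `x` and
`e` is less than `c`, then some point in a smaller face has Rayleigh quotient less than `c`. -/
theorem exists_mem_smaller_face {M : Matrix (Fin d) (Fin d) ℝ} (hM : M.IsHermitian)
    {A : Matrix (Fin k) (Fin d) ℝ} {I : Finset (Fin k)} {x e : Euc d} {c : ℝ}
    (hx : x ∈ cornerCone A 0) (hxI : x ∈ activeDirections A I) (heI : e ∈ activeDirections A I)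
    (he : e ∉ cornerCone A 0) (he' : -e ∉ cornerCone A 0)
    (hfx : quadForm M x < c * ‖x‖ ^ 2) (hfe : quadForm M e < c * ‖e‖ ^ 2) :
    ∃ i ∉ I, activeDirections A (insert i I) < activeDirections A I ∧
      ∃ y ∈ cornerCone A 0, y ∈ activeDirections A (insert i I) ∧
        quadForm M y < c * ‖y‖ ^ 2 := by
  -- Choose the sign of `e` that makes the cross term of `f - c * ‖·‖²` nonpositive.
  obtain ⟨w, hw, hwI, hfw, hβ⟩ : ∃ w ∉ cornerCone A 0, w ∈ activeDirections A I ∧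
      quadForm M w < c * ‖w‖ ^ 2 ∧
      ⟪Matrix.toEuclideanCLM (𝕜 := ℝ) M x, w⟫ - 2 * c * ⟪x, w⟫ ≤ 0 := by
    rcases le_total (⟪Matrix.toEuclideanCLM (𝕜 := ℝ) M x, e⟫ - 2 * c * ⟪x, e⟫) 0 with h | h
    · exact ⟨e, he, heI, hfe, h⟩
    · refine ⟨-e, he', neg_mem heI, by rwa [quadForm_neg, norm_neg], ?_⟩
      rw [inner_neg_right, inner_neg_right]
      linarith
  obtain ⟨s, hs0, hs1, i, hi, hy, hyi⟩ := exists_facet_crossing hx hw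
  have hiI : i ∉ I := fun h => hi.ne' (hwI i h)
  have hyI : (1 - s) • x + s • w ∈ activeDirections A I :=
    add_mem (Submodule.smul_mem _ _ hxI) (Submodule.smul_mem _ _ hwI)
  -- The inclusion is strict because `w` satisfies the constraints from `I` with equality but
  -- violates `i`.
  refine ⟨i, hiI, lt_of_le_of_ne (fun v hv j hj => hv j (Finset.mem_insert_of_mem hj)) ?_,
    (1 - s) • x + s • w, hy, ?_, ?_⟩
  · intro h
    rw [← h] at hwI
    exact hi.ne' (hwI i (Finset.mem_insert_self _ _))
  · intro j hj
    rcases Finset.mem_insert.1 hj with rfl | hj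
    · exact hyi
    · exact hyI j hj
  · rw [quadForm_smul_add_smul hM, norm_sq_smul_add_smul]
    have h1 : (1 - s) * s * (⟪Matrix.toEuclideanCLM (𝕜 := ℝ) M x, w⟫ - 2 * c * ⟪x, w⟫) ≤ 0 :=
      mul_nonpos_of_nonneg_of_nonpos (mul_nonneg (by linarith) hs0) hβ
    -- Strictness comes from `x` if `s = 0` and from `w` otherwise.
    have h2 : (1 - s) ^ 2 * (quadForm M x - c * ‖x‖ ^ 2)
        + s ^ 2 * (quadForm M w - c * ‖w‖ ^ 2) < 0 := by
      rcases hs0.eq_or_lt with rfl | hs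
      · linarith
      · have h3 : (1 - s) ^ 2 * (quadForm M x - c * ‖x‖ ^ 2) ≤ 0 :=
          mul_nonpos_of_nonneg_of_nonpos (sq_nonneg _) (by linarith)
        have h4 : s ^ 2 * (quadForm M w - c * ‖w‖ ^ 2) < 0 :=
          mul_neg_of_pos_of_neg (by positivity) (by linarith)
        linarith
    linarith

/-- If `f` is negative at some point of a subspace, then there is a direction `u` such that the
projected power method in this subspace is nearly optimal for every initial noise which is not
almost orthogonal to `u`. -/
theorem exists_direction_findInsideCorner {M : Matrix (Fin d) (Fin d) ℝ} (hM : M.IsHermitian)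
    {L : ℝ} (hL : 0 < L) (hML : lambdaAbsMax hM ≤ L) {V : Submodule ℝ (Euc d)} {x : Euc d}
    (hx : x ∈ V) {c r : ℝ} (hr : 0 < r) (hc : c < 0) (hfx : quadForm M x < c / r ^ 2 * ‖x‖ ^ 2)
    {T : ℕ} (hT : 0 < T) {Λ : ℝ} (hΛ : 0 ≤ Λ) :
    ∃ u : Euc d, ‖u‖ = 1 ∧ ∀ ζ : Euc d,
      Real.exp (-Λ) * ‖ζ‖ ^ 2 ≤ ⟪u, ζ⟫ ^ 2 ∧ ⟪u, ζ⟫ ≠ 0 →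
        ∃ e : Euc d,
          (findInsideCorner 0 (AffineSubspace.mk' 0 V) r (1 / L) T ζ).eval (quadForm M) = e ∧
          e ∈ V ∧ ‖e‖ = r ∧ quadForm M e < c + L * r ^ 2 * Λ / (2 * T) := by
  have hx0 : x ≠ 0 := by rintro rfl; simp [quadForm_zero] at hfx
  have hx2 : 0 < ‖x‖ ^ 2 := by positivity
  have : Nontrivial (Euc d) := ⟨x, 0, hx0⟩
  have hB := stepOp_isPositive hM hL hML V
  obtain ⟨μ, u, hu1, hu, hmax⟩ := exists_unit_eigenvector_ge hB.isSymmetric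
  simp only [ContinuousLinearMap.coe_coe] at hu hmax
  have hμlow : 1 - 2 * c / (L * r ^ 2) < μ := by
    have h1 := hmax x
    rw [inner_stepOp_of_mem M _ V hx] at h1
    have h2 : 2 * (1 / L) * quadForm M x < 2 * (1 / L) * (c / r ^ 2 * ‖x‖ ^ 2) :=
      mul_lt_mul_of_pos_left hfx (by positivity)
    have h3 : (1 - 2 * c / (L * r ^ 2)) * ‖x‖ ^ 2 =
        ‖x‖ ^ 2 - 2 * (1 / L) * (c / r ^ 2 * ‖x‖ ^ 2) := by
      field_simp
    refine lt_of_mul_lt_mul_right (a := ‖x‖ ^ 2) ?_ hx2.le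
    rw [h3]
    linarith
  have hμ1 : 1 < μ := by
    have : 2 * c / (L * r ^ 2) < 0 := div_neg_of_neg_of_pos (by linarith) (by positivity)
    linarith
  have hμ0 : 0 < μ := by linarith
  -- As `μ ≠ 0`, the eigenvector is in the range of the operator. Hence projecting the noise to `V`
  -- keeps its component along `u`.
  have huV : u ∈ V := by
    have h : u = stepOp M (1 / L) V (μ⁻¹ • u) := by
      rw [map_smul, hu, smul_smul, inv_mul_cancel₀ hμ0.ne', one_smul]
    rw [h]
    exact stepOp_mem M _ V _
  -- Needed to turn the relative loss `Λ / (2 T)` in `μ` into an additive loss in `f`.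
  have hμ2 : μ ≤ 2 := by
    have h1 := inner_stepOp_of_mem M (1 / L) V huV
    rw [hu, real_inner_smul_left, real_inner_self_eq_norm_sq, hu1, quadForm_eq_inner] at h1
    have h2 := (neg_abs_le _).trans' (neg_le_neg (abs_inner_toEuclideanCLM_le hM u))
    rw [hu1] at h2
    have h3 : -1 ≤ 1 / L * ⟪Matrix.toEuclideanCLM (𝕜 := ℝ) M u, u⟫ := by
      rw [one_div, le_inv_mul_iff₀ hL]; linarith
    linarith
  refine ⟨u, hu1, fun ζ hζ => ⟨_, rfl, ?_⟩⟩
  rw [findInsideCorner_eval hM]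
  set z := V.starProjection ζ with hz
  have hzV : z ∈ V := V.starProjection_apply_mem ζ
  have huz : ⟪u, z⟫ = ⟪u, ζ⟫ := by
    rw [hz, ← V.inner_starProjection_left_eq_right, V.starProjection_eq_self_iff.2 huV]
  have hz0 : z ≠ 0 := by
    intro h
    rw [h, inner_zero_right] at huz
    exact hζ.2 huz.symm
  have hzn : ‖z‖ ≤ ‖ζ‖ := V.norm_starProjection_apply_le ζ
  have hq : Real.exp (-Λ) * ‖z‖ ^ 2 ≤ ⟪u, z⟫ ^ 2 := by
    rw [huz]
    refine le_trans ?_ hζ.1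
    gcongr
  obtain ⟨hw0, hray⟩ := rayleigh_power_iterate_ge hB hμ0 hu hu1 hz0 hq hT
  set w := ((stepOp M (1 / L) V).toLinearMap ^ T) z with hw
  have hwV : w ∈ V := pow_stepOp_mem M _ V T hzV
  have hwn : 0 < ‖w‖ := norm_pos_iff.2 hw0
  simp only [ContinuousLinearMap.coe_coe] at hray
  rw [inner_stepOp_of_mem M _ V hwV] at hray
  refine ⟨V.smul_mem _ hwV, ?_, ?_⟩
  · rw [norm_smul, norm_div, norm_norm, div_mul_cancel₀ _ hwn.ne', Real.norm_of_nonneg hr.le]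
  · have hTR : (0 : ℝ) < T := by exact_mod_cast hT
    have h1 : quadForm M ((r / ‖w‖) • w) = r ^ 2 / ‖w‖ ^ 2 * quadForm M w := by
      have := quadForm_smul_add_smul hM (r / ‖w‖) 0 w 0
      simp only [zero_smul, add_zero] at this
      rw [this]; ring
    have h2 : quadForm M w ≤ L / 2 * (1 - μ * (1 - Λ / (2 * T))) * ‖w‖ ^ 2 := by
      have h3 : 2 * (1 / L) * quadForm M w ≤ (1 - μ * (1 - Λ / (2 * T))) * ‖w‖ ^ 2 := by
        linarith
      have h4 := mul_le_mul_of_nonneg_left h3 (by positivity : 0 ≤ L / 2)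
      have h5 : L / 2 * (2 * (1 / L) * quadForm M w) = quadForm M w := by field_simp
      rw [h5] at h4
      linarith
    have h6 : μ * (Λ / (2 * T)) ≤ 2 * (Λ / (2 * T)) :=
      mul_le_mul_of_nonneg_right hμ2 (by positivity)
    have h7 : 1 - μ * (1 - Λ / (2 * T)) < 2 * c / (L * r ^ 2) + 2 * (Λ / (2 * T)) := by
      linarith
    rw [h1]
    calc r ^ 2 / ‖w‖ ^ 2 * quadForm M w
        ≤ r ^ 2 / ‖w‖ ^ 2 * (L / 2 * (1 - μ * (1 - Λ / (2 * T))) * ‖w‖ ^ 2) :=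
          mul_le_mul_of_nonneg_left h2 (by positivity)
      _ = r ^ 2 * (L / 2) * (1 - μ * (1 - Λ / (2 * T))) := by field_simp
      _ < r ^ 2 * (L / 2) * (2 * c / (L * r ^ 2) + 2 * (Λ / (2 * T))) :=
          mul_lt_mul_of_pos_left h7 (by positivity)
      _ = c + L * r ^ 2 * Λ / (2 * T) := by field_simp

end Geometry

/-! ### The probability of failure -/

section Failure

variable {d k : ℕ}

instance : IsProbabilityMeasure (noiseLaw d k) := by
  unfold noiseLaw; infer_instance

/-- Only the marginals of the noise enter the proof, not independence. The inequality holds for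
arbitrary `s`, which avoids measurability questions. -/
theorem noiseLaw_eval_le (I : Finset (Fin k)) (s : Set (Euc d)) :
    noiseLaw d k {noise | noise I ∈ s} ≤ stdGaussian (Euc d) s := by
  have h : MeasurePreserving (Function.eval I) (noiseLaw d k) (stdGaussian (Euc d)) :=
    measurePreserving_eval (fun _ : Finset (Fin k) => stdGaussian (Euc d)) I
  rw [← h.map_eq]
  exact Measure.le_map_apply h.measurable.aemeasurable s

/-- The search fails on all constraint sets containing `I` with probability at most `n * ξ / d`
if the face of `I` has dimension at most `n` and contains a point with sufficiently negative
value. -/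
theorem noiseLaw_no_escape_le {M : Matrix (Fin d) (Fin d) ℝ} (hM : M.IsHermitian)
    {L δ r ξ ε Λ : ℝ} (hL : 0 < L) (hr : 0 < r) (hξ : 0 < ξ) (hξ1 : ξ ≤ 1)
    (hML : lambdaAbsMax hM ≤ L) (A : Matrix (Fin k) (Fin d) ℝ) {T : ℕ} (hT : 0 < T)
    (hε : 0 < ε) (hεδ : (k + 1) * ε ≤ δ / 2) (hΛ : 0 ≤ Λ) (hΛξ : Real.exp (-Λ) = (ξ / (2 * d)) ^ 4)
    (hTε : L * r ^ 2 * Λ / (2 * T) ≤ ε) (n : ℕ) (I : Finset (Fin k))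
    (hn : Module.finrank ℝ (activeDirections A I) ≤ n) {x : Euc d} (hx : x ∈ cornerCone A 0)
    (hxI : x ∈ activeDirections A I)
    (hfx : quadForm M x < (-δ + I.card * ε) / r ^ 2 * ‖x‖ ^ 2) :
    noiseLaw d k {noise | ∀ J, I ⊆ J → ¬ (
      IsEscape (quadForm M) A δ
        ((findInsideCorner 0 (activeSubspace A 0 J) r (1 / L) T (noise J)).eval (quadForm M)) ∨
      IsEscape (quadForm M) A δ
        (-(findInsideCorner 0 (activeSubspace A 0 J) r (1 / L) T (noise J)).eval (quadForm M)))}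
      ≤ n * ENNReal.ofReal (ξ / d) := by
  have hx0 : x ≠ 0 := by rintro rfl; simp [quadForm_zero] at hfx
  induction n generalizing I x with
  | zero =>
    have h : activeDirections A I = ⊥ := Submodule.finrank_eq_zero.1 (by omega)
    rw [h] at hxI
    exact absurd ((Submodule.mem_bot ℝ).1 hxI) hx0
  | succ n ih =>
    have hcard : (I.card : ℝ) ≤ k := by
      exact_mod_cast (Finset.card_le_univ I).trans_eq (Fintype.card_fin k)
    have hcard' : (I.card : ℝ) * ε ≤ k * ε := mul_le_mul_of_nonneg_right hcard hε.le
    have hδ : 0 < δ := by nlinarith [mul_nonneg (Nat.cast_nonneg (α := ℝ) k) hε.le]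
    -- The budget: at most `k` losses on the way to this face, and one for the present run.
    have hc : -δ + I.card * ε + ε ≤ -(δ / 2) := by linarith
    obtain ⟨u, hu1, hu⟩ := exists_direction_findInsideCorner hM hL hML hxI hr (by linarith) hfx
      hT hΛ
    have hd : 0 < Module.finrank ℝ (Euc d) :=
      Module.finrank_pos_iff_exists_ne_zero.2 ⟨x, hx0⟩
    have hbad := stdGaussian_small_component_le hu1 hξ hξ1 hd
    simp only [finrank_euclideanSpace_fin, ← hΛξ] at hbad
    set bad : Set (Euc d) := {ζ | ¬ (Real.exp (-Λ) * ‖ζ‖ ^ 2 ≤ ⟪u, ζ⟫ ^ 2 ∧ ⟪u, ζ⟫ ≠ 0)}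
      with hbad_def
    have hbad' := (noiseLaw_eval_le (k := k) I bad).trans hbad
    rw [Nat.cast_succ, add_mul, one_mul]
    -- If every good noise succeeds, failure forces `noise I ∈ bad`. Otherwise a fixed failing `ζ`,
    -- unrelated to the random `noise`, supplies the point for the induction hypothesis. Each case
    -- uses only one of the two summands.
    by_cases hall : ∀ ζ ∉ bad,
      IsEscape (quadForm M) A δ
        ((findInsideCorner 0 (activeSubspace A 0 I) r (1 / L) T ζ).eval (quadForm M)) ∨
      IsEscape (quadForm M) A δ
        (-(findInsideCorner 0 (activeSubspace A 0 I) r (1 / L) T ζ).eval (quadForm M))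
    · refine le_trans (measure_mono fun noise hnoise => ?_) (hbad'.trans le_add_self)
      by_contra hc
      exact hnoise I subset_rfl (hall _ hc)
    · push Not at hall
      obtain ⟨ζ, hζ, he1, he2⟩ := hall
      obtain ⟨e, hee, heV, her, hfe⟩ := hu ζ (not_not.1 hζ)
      rw [hee] at he1 he2
      have hfe2 : quadForm M e < -δ + I.card * ε + ε := by linarith
      have hfe3 : quadForm M e < quadForm M 0 - δ / 2 := by rw [quadForm_zero]; linarith
      have he1' : e ∉ cornerCone A 0 := fun h => he1 ⟨h, hfe3⟩
      have he2' : -e ∉ cornerCone A 0 := fun h => he2 ⟨h, by rwa [quadForm_neg]⟩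
      obtain ⟨i, hiI, hlt, y, hy, hyI, hfy⟩ := exists_mem_smaller_face hM
        (c := (-δ + (I.card + 1) * ε) / r ^ 2) hx hxI heV he1' he2'
        (hfx.trans_le (by gcongr; linarith))
        (by
          rw [her, div_mul_cancel₀ _ (by positivity)]
          linarith)
      have hy0 : y ≠ 0 := by rintro rfl; simp [quadForm_zero] at hfy
      have hrank := Submodule.finrank_lt_finrank_of_lt hlt
      have hih := ih (insert i I) (by omega) hy hyI
        (by rw [Finset.card_insert_of_notMem hiI]; push_cast; exact hfy) hy0
      refine le_trans (measure_mono ?_) (hih.trans le_self_add)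
      intro noise hnoise J hJ
      exact hnoise J ((Finset.subset_insert i I).trans hJ)

end Failure

/-! ### Choice of the parameters and conclusion -/

theorem theorem2 :
    ∃ C : ℝ, 0 < C ∧
      ∀ (d k : ℕ) (L δ r ξ : ℝ), 0 < δ → 0 < r → 0 < ξ → ξ < 1 →
        ∃ T : ℕ,
          ∀ (M : Matrix (Fin d) (Fin d) ℝ) (hM : M.IsHermitian) (A : Matrix (Fin k) (Fin d) ℝ)
            (order : List (Finset (Fin k))),
            lambdaAbsMax hM ≤ L →
            order.Nodup → (∀ I : Finset (Fin k), I ∈ order) →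
            IsQCSP (quadForm M) (cornerCone A 0) δ r →
              ENNReal.ofReal (1 - ξ) ≤ noiseLaw d k
                {noise | ∃ y ∈ cornerCone A 0 ∩ Metric.closedBall (0 : Euc d) r,
                  (houdiniEscapeCorner 0 A δ r (1 / L) T noise order).eval (quadForm M) = some y ∧
                  quadForm M y < -(δ / 2)} ∧
              ∀ noise : Finset (Fin k) → Euc d,
                (((houdiniEscapeCorner 0 A δ r (1 / L) T noise order).gradCalls
                    (quadForm M) : ℕ) : ℝ) ≤
                  C * (L * r ^ 2 * (max k 1 : ℕ) * 2 ^ k / δ) * Real.log (2 * d / ξ) := by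
  -- `20 = 2 * 5 * 2`: two gradients per step, `4 + 1` from `Λ = 4 ℓ` and rounding up `T`, and `k +
  -- 1 ≤ 2 * max k 1`.
  refine ⟨20, by norm_num, fun d k L δ r ξ hδ hr hξ hξ1 => ?_⟩
  set ℓ := Real.log (2 * d / ξ) with hℓ
  refine ⟨⌈L * r ^ 2 * (4 * ℓ) * (k + 1) / δ⌉₊, fun M hM A order hML hnodup hmem hq => ?_⟩
  set T := ⌈L * r ^ 2 * (4 * ℓ) * (k + 1) / δ⌉₊ with hTdef
  obtain ⟨x, ⟨hxr, hx⟩, hfx⟩ := hq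
  have hxr : ‖x‖ ≤ r := by simpa using hxr
  have hx0 : x ≠ 0 := by rintro rfl; rw [quadForm_zero] at hfx; linarith
  have hd : 0 < d := by
    have h : 0 < Module.finrank ℝ (Euc d) := Module.finrank_pos_iff_exists_ne_zero.2 ⟨x, hx0⟩
    simpa using h
  have hdR : (1 : ℝ) ≤ d := by exact_mod_cast hd
  have hx2 : 0 < ‖x‖ ^ 2 := by positivity
  have hxr2 : ‖x‖ ^ 2 ≤ r ^ 2 := pow_le_pow_left₀ (norm_nonneg _) hxr 2
  -- A value below `-δ` forces `L` to be large; this also yields `0 < L`, which is not assumed.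
  have hlow : 2 * δ < L * ‖x‖ ^ 2 := by
    have h1 := (abs_inner_toEuclideanCLM_le hM x).trans
      (mul_le_mul_of_nonneg_right hML (sq_nonneg ‖x‖))
    have h2 := neg_abs_le ⟪Matrix.toEuclideanCLM (𝕜 := ℝ) M x, x⟫
    rw [quadForm_eq_inner] at hfx
    linarith
  have hL : 0 < L := pos_of_mul_pos_left (by linarith : 0 < L * ‖x‖ ^ 2) (sq_nonneg _)
  have hLr : 2 * δ < L * r ^ 2 := hlow.trans_le (mul_le_mul_of_nonneg_left hxr2 hL.le)
  have hℓ2 : 1 / 2 < ℓ := by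
    have h1 : Real.log 2 ≤ ℓ := by
      refine Real.log_le_log two_pos ?_
      rw [le_div_iff₀ hξ]
      nlinarith
    linarith [Real.log_two_gt_d9]
  -- Lets the `+ 1` from the ceiling be absorbed in the bound on `T`.
  have hX1 : 1 ≤ L * r ^ 2 * ℓ * (k + 1) / δ := by
    rw [one_le_div hδ]
    have h1 : δ ≤ L * r ^ 2 * ℓ := by nlinarith
    have h2 : (0 : ℝ) ≤ k := Nat.cast_nonneg k
    nlinarith
  have hTge : L * r ^ 2 * (4 * ℓ) * (k + 1) / δ ≤ T := Nat.le_ceil _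
  have hX4 : L * r ^ 2 * (4 * ℓ) * (k + 1) / δ = 4 * (L * r ^ 2 * ℓ * (k + 1) / δ) := by ring
  have hTpos : (0 : ℝ) < T := by rw [hX4] at hTge; linarith
  have hTle : (T : ℝ) ≤ 5 * (L * r ^ 2 * ℓ * (k + 1) / δ) := by
    have h := Nat.ceil_lt_add_one (by rw [hX4]; linarith : 0 ≤ L * r ^ 2 * (4 * ℓ) * (k + 1) / δ)
    rw [← hTdef, hX4] at h
    linarith
  refine ⟨?_, fun noise => ?_⟩
  -- `Λ = 4 ℓ` matches the fourth power in `stdGaussian_small_component_le`.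
  · have hexp : Real.exp (-(4 * ℓ)) = (ξ / (2 * d)) ^ 4 := by
      rw [hℓ, ← mul_neg, ← Real.log_inv, inv_div]
      have hp : 0 < ξ / (2 * d) := by positivity
      rw [show (4 : ℝ) * Real.log (ξ / (2 * d)) = (4 : ℕ) * Real.log (ξ / (2 * d)) by norm_num,
        Real.exp_nat_mul, Real.exp_log hp]
    have hfail := noiseLaw_no_escape_le hM (ε := δ / (2 * (k + 1))) (Λ := 4 * ℓ) (δ := δ)
      (T := T) hL hr hξ hξ1.le hML A (by exact_mod_cast hTpos) (by positivity)
      (le_of_eq (by field_simp)) (by linarith) hexp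
      (by
        rw [div_le_div_iff₀ (by positivity) (by positivity)]
        rw [div_le_iff₀ hδ] at hTge
        nlinarith)
      d ∅ ((Submodule.finrank_le _).trans_eq finrank_euclideanSpace_fin) hx
      (fun i hi => absurd hi (Finset.notMem_empty i))
      (by
        refine hfx.trans_le ?_
        simp only [Finset.card_empty, Nat.cast_zero, zero_mul, add_zero]
        rw [neg_div, neg_mul, neg_le_neg_iff, div_mul_eq_mul_div, div_le_iff₀ (by positivity)]
        exact mul_le_mul_of_nonneg_left hxr2 hδ.le)
    rw [← ENNReal.ofReal_natCast, ← ENNReal.ofReal_mul (Nat.cast_nonneg _),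
      mul_div_cancel₀ _ (by positivity)] at hfail
    have huniv : (1 : ENNReal) ≤ _ := (measure_univ (μ := noiseLaw d k)).ge
    rw [ENNReal.ofReal_sub _ hξ.le, ENNReal.ofReal_one, tsub_le_iff_right]
    -- Success and failure cover the whole space, so subadditivity suffices and neither event has to
    -- be measurable.
    refine huniv.trans ((measure_mono fun noise _ => ?_).trans
      ((measure_union_le _ _).trans (add_le_add_right hfail _)))
    by_cases h : ∃ I ∈ order,
      IsEscape (quadForm M) A δ
        ((findInsideCorner 0 (activeSubspace A 0 I) r (1 / L) T (noise I)).eval (quadForm M)) ∨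
      IsEscape (quadForm M) A δ
        (-(findInsideCorner 0 (activeSubspace A 0 I) r (1 / L) T (noise I)).eval (quadForm M))
    · left
      obtain ⟨y, hy, hey, hfy⟩ := houdiniEscapeCorner_eval_of_isEscape _ A hr _ T noise order h
      exact ⟨y, hy, hey, by rw [quadForm_zero] at hfy; linarith⟩
    · right
      intro J _ hJ
      exact h ⟨J, hmem J, hJ⟩
  · have hlen : order.length ≤ 2 ^ k := by
      have h := hnodup.length_le_card
      simpa using h
    have hcalls := gradCalls_houdiniEscapeCorner_le (quadForm M) 0 A δ r (1 / L) T noise order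
    have h1 : (((houdiniEscapeCorner 0 A δ r (1 / L) T noise order).gradCalls
        (quadForm M) : ℕ) : ℝ) ≤ 2 * T * 2 ^ k := by
      exact_mod_cast hcalls.trans (Nat.mul_le_mul_left _ hlen)
    have hk : (k : ℝ) + 1 ≤ 2 * (max k 1 : ℕ) := by
      have : k + 1 ≤ 2 * max k 1 := by omega
      exact_mod_cast this
    have hY : 0 ≤ L * r ^ 2 * ℓ / δ := by
      have : 0 ≤ ℓ := by linarith
      positivity
    calc _ ≤ 2 * (T : ℝ) * 2 ^ k := h1
      _ ≤ 2 * (5 * (L * r ^ 2 * ℓ * (k + 1) / δ)) * 2 ^ k := by gcongr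
      _ = 10 * 2 ^ k * (L * r ^ 2 * ℓ / δ) * (k + 1) := by ring
      _ ≤ 10 * 2 ^ k * (L * r ^ 2 * ℓ / δ) * (2 * (max k 1 : ℕ)) := by gcongr
      _ = _ := by ring
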